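/- Let $k$ be a field and let $\Lambda$ be a finite-dimensional (associative, unital) $k$-algebra with enveloping algebra $\Lambda^{e}=\Lambda\otimes_k\Lambda^{\mathrm{op}}$; regard $\Lambda$ as a left $\Lambda^{e}$-module via $(a\otimes b)\cdot x=axb$. For a finitely generated left $\Lambda^{e}$-module $M$, let $\Omega_{\Lambda^e}(M)$ be the kernel of a projective cover of $M$, and put $\Omega^{0}_{\Lambda^e}(M)=M$ and $\Omega^{i+1}_{\Lambda^e}(M)=\Omega_{\Lambda^e}(\Omega^{i}_{\Lambda^e}(M))$; these modules are determined up to isomorphism. Call $M$ periodic if $\Omega^{q}_{\Lambda^e}(M)\cong M$ for some $q>0$; the least such $q$ is the period of $M$. Let $d,n,p$ be non-negative integers. Assume that $\Lambda$ is $d$-Gorenstein, i.e. $\Lambda$ has finite injective dimension both as a left and as a right module over itself, and $\operatorname{inj.dim}_{\Lambda}\Lambda=d$. Assume also that $\Lambda$ is $(n,p)$-eventually periodic, i.e. $n$ is the bimodule periodic dimension of $\Lambda$ (the least integer $i\ge 0$ such that $\Omega^{i}_{\Lambda^e}(\Lambda)$ is periodic) and $p$ is the period of $\Omega^{n}_{\Lambda^e}(\Lambda)$.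 Then $$d\le n\le d+1,$$ and there are a finitely generated projective left $\Lambda^{e}$-module $P$ and an isomorphism of $\Lambda^{e}$-modules $$\Omega^{d+p}_{\Lambda^e}(\Lambda)\oplus P\cong\Omega^{d}_{\Lambda^e}(\Lambda).$$ In particular, $n=d$ if and only if $\Omega^{d}_{\Lambda^e}(\Lambda)$ has no nonzero projective direct summand. -/

import Mathlib

open CategoryTheory TensorProduct

universe v u

/-! ### Projective covers and syzygies -/

section Syzygies

variable {R : Type u} [Ring R]

/-- A projective cover of a left module `M`: a surjection `π : P → M` from a projective module whose
kernel is superfluous (a submodule `N` of `P` with `N + ker π = P` is all of `P`). -/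
structure IsProjectiveCover {P M : Type*} [AddCommGroup P] [Module R P] [AddCommGroup M]
    [Module R M] (π : P →ₗ[R] M) : Prop where
  projective : Module.Projective R P
  surjective : Function.Surjective π
  superfluous : ∀ N : Submodule R P, N ⊔ LinearMap.ker π = ⊤ → N = ⊤

/-- Over a left artinian ring, every finitely generated left module has a finitely generated
projective cover. -/
theorem exists_isProjectiveCover [IsArtinianRing R] (M : FGModuleCat.{u} R) :
    ∃ (P : FGModuleCat.{u} R) (π : P →ₗ[R] M), IsProjectiveCover π := by
  obtain ⟨n, f, hf⟩ := Module.Finite.exists_fin' R M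
  let S : Set (Submodule R (Fin n → R)) :=
    {N | Module.Projective R N ∧ N.map f = ⊤}
  have hS : S.Nonempty := by
    refine ⟨⊤, ?_, ?_⟩
    · exact Module.Projective.of_equiv (Submodule.topEquiv (R := R) (M := Fin n → R)).symm
    · rw [Submodule.map_top, LinearMap.range_eq_top.2 hf]
  obtain ⟨N, ⟨hNp, hNf⟩, hNmin⟩ := WellFounded.has_min (wellFounded_lt (α := Submodule R (Fin n → R))) S hS
  let π : N →ₗ[R] M := f.comp N.subtype
  have hπ : Function.Surjective π := by
    intro m
    have hm : m ∈ N.map f := by rw [hNf]; trivial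
    obtain ⟨x, hx, rfl⟩ := hm
    exact ⟨⟨x, hx⟩, rfl⟩
  refine ⟨FGModuleCat.of R N, π, hNp, hπ, ?_⟩
  intro L₀ hL₀
  -- a submodule of `L₀`, minimal among those that still surject onto `M`
  let T : Set (Submodule R N) := {L | L ≤ L₀ ∧ L.map π = ⊤}
  have hT : T.Nonempty := by
    refine ⟨L₀, le_rfl, ?_⟩
    rw [eq_top_iff]
    rintro m -
    obtain ⟨x, rfl⟩ := hπ m
    have hx : x ∈ L₀ ⊔ LinearMap.ker π := by rw [hL₀]; trivial
    obtain ⟨y, hy, z, hz, rfl⟩ := Submodule.mem_sup.1 hx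
    exact ⟨y, hy, by rw [map_add, LinearMap.mem_ker.1 hz, add_zero]⟩
  obtain ⟨L, ⟨hLL₀, hLπ⟩, hLmin⟩ := WellFounded.has_min (wellFounded_lt (α := Submodule R N)) T hT
  have hρ : Function.Surjective (π.comp L.subtype) := by
    intro m
    have hm : m ∈ L.map π := by rw [hLπ]; trivial
    obtain ⟨x, hx, rfl⟩ := hm
    exact ⟨⟨x, hx⟩, rfl⟩
  obtain ⟨g, hg⟩ := Module.projective_lifting_property (π.comp L.subtype) π hρ
  have hg' : ∀ x, π (g x : N) = π x := fun x ↦ LinearMap.congr_fun hg x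
  -- the lift restricted to `L` is surjective by minimality of `L`, hence bijective
  let h : L →ₗ[R] L := g.comp L.subtype
  have hh : Function.Surjective h := by
    have hle : (LinearMap.range h).map L.subtype ≤ L := Submodule.map_subtype_le _ _
    have hmem : (LinearMap.range h).map L.subtype ∈ T := by
      refine ⟨hle.trans hLL₀, ?_⟩
      rw [eq_top_iff]
      rintro m -
      obtain ⟨x, rfl⟩ := hρ m
      exact ⟨g x, ⟨h x, ⟨x, rfl⟩, rfl⟩, hg' x⟩
    have heq : (LinearMap.range h).map L.subtype = L := by
      by_contra hne
      exact hLmin _ hmem (lt_of_le_of_ne hle hne)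
    intro x
    have hx : (x : N) ∈ (LinearMap.range h).map L.subtype := by rw [heq]; exact x.2
    obtain ⟨y, ⟨z, rfl⟩, hy⟩ := hx
    exact ⟨z, Subtype.ext hy⟩
  have hN : IsNoetherian R N := inferInstance
  have hLN : IsNoetherian R L := isNoetherian_submodule' L
  have hinj : Function.Injective h :=
    IsNoetherian.injective_of_surjective_endomorphism (M := L) h hh
  let e : L ≃ₗ[R] L := LinearEquiv.ofBijective h ⟨hinj, hh⟩
  have hLproj : Module.Projective R L := by
    refine Module.Projective.of_split L.subtype (e.symm.toLinearMap.comp g) ?_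
    ext1 x
    exact e.symm_apply_apply x
  have hL' : L.map N.subtype ∈ S := by
    refine ⟨Module.Projective.of_equiv (Submodule.equivSubtypeMap N L), ?_⟩
    rw [← Submodule.map_comp]
    exact hLπ
  have hLtop : L = ⊤ := by
    have h1 : L.map N.subtype = N := by
      by_contra hne
      exact hNmin _ hL' (lt_of_le_of_ne (Submodule.map_subtype_le _ _) hne)
    rw [eq_top_iff]
    rintro x -
    have hx : (x : Fin n → R) ∈ L.map N.subtype := by rw [h1]; exact x.2
    obtain ⟨y, hy, hyx⟩ := hx
    rwa [← Subtype.ext hyx]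
  exact top_le_iff.1 (hLtop ▸ hLL₀)

variable [IsArtinianRing R]

/-- The projective cover `P(M)` of a finitely generated module `M`. -/
noncomputable def projectiveCover (M : FGModuleCat.{u} R) : FGModuleCat.{u} R :=
  (exists_isProjectiveCover M).choose

/-- The projection `P(M) → M` of the projective cover. -/
noncomputable def projectiveCoverπ (M : FGModuleCat.{u} R) : projectiveCover M →ₗ[R] M :=
  (exists_isProjectiveCover M).choose_spec.choose

theorem isProjectiveCover_projectiveCoverπ (M : FGModuleCat.{u} R) :
    IsProjectiveCover (projectiveCoverπ M) :=
  (exists_isProjectiveCover M).choose_spec.choose_spec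

/-- The syzygy `Ω(M)`: the kernel of the projective cover `P(M) → M`. -/
noncomputable def syzygy (M : FGModuleCat.{u} R) : FGModuleCat.{u} R :=
  FGModuleCat.of R (LinearMap.ker (projectiveCoverπ M))

/-- The `n`-th syzygy: `Ω⁰(M) = M` and `Ωⁿ⁺¹(M) = Ω(Ωⁿ(M))`. -/
noncomputable def iteratedSyzygy : ℕ → FGModuleCat.{u} R → FGModuleCat.{u} R
  | 0, M => M
  | n + 1, M => syzygy (iteratedSyzygy n M)

/-- `M` is periodic: `Ωᵖ(M) ≅ M` for some `p > 0`. -/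
def IsPeriodicModule (M : FGModuleCat.{u} R) : Prop :=
  ∃ p : ℕ, 0 < p ∧ Nonempty (iteratedSyzygy p M ≃ₗ[R] M)

/-- `M` is periodic of period `p`: `p` is the least positive integer with `Ωᵖ(M) ≅ M`. -/
def IsPeriodicModuleOfPeriod (p : ℕ) (M : FGModuleCat.{u} R) : Prop :=
  IsLeast {q : ℕ | 0 < q ∧ Nonempty (iteratedSyzygy q M ≃ₗ[R] M)} p

/-- The periodic dimension of `M`: the infimum in `ℕ ∪ {∞}` of all `n` such that `Ωⁿ(M)` is
periodic. -/
noncomputable def periodicDimension (M : FGModuleCat.{u} R) : ℕ∞ :=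
  ⨅ (n : ℕ) (_ : IsPeriodicModule (iteratedSyzygy n M)), (n : ℕ∞)

/-- `M` is `(n, p)`-eventually periodic: its `n`-th syzygy is its first periodic syzygy, and the
period of that syzygy is `p`. -/
def IsEventuallyPeriodicModule (n p : ℕ) (M : FGModuleCat.{u} R) : Prop :=
  periodicDimension M = n ∧ IsPeriodicModuleOfPeriod p (iteratedSyzygy n M)

end Syzygies

/-- A module has no nonzero projective direct summand. -/
def HasNoProjectiveSummand (R M : Type*) [Ring R] [AddCommGroup M] [Module R M] : Prop :=
  ∀ Q N : Submodule R M, IsCompl Q N → Module.Projective R Q → Q = ⊥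

/-! ### Gorenstein rings -/

/-- A `d`-Gorenstein ring: a two-sided noetherian ring with finite injective dimension as a left and
as a right module over itself, the left one being `d`. (Right `R`-modules are left modules over
`Rᵐᵒᵖ`.) -/
structure IsGorensteinRingOfDim (d : ℕ) (R : Type u) [Ring R] : Prop where
  noetherian_left : IsNoetherianRing R
  noetherian_right : IsNoetherianRing Rᵐᵒᵖ
  injectiveDimension_left : injectiveDimension (ModuleCat.of.{u} R R) = d
  injectiveDimension_right : injectiveDimension (ModuleCat.of.{u} Rᵐᵒᵖ R) < ⊤

/-! ### The enveloping algebra and the regular bimodule -/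

section Bimodules

variable (k : Type v) (Λ : Type u) [Field k] [Ring Λ] [Algebra k Λ]

/-- The enveloping algebra `Λᵉ = Λ ⊗ₖ Λᵒᵖ`. -/
abbrev EnvelopingAlgebra : Type u := Λ ⊗[k] Λᵐᵒᵖ

/-- The regular bimodule `Λ` as a left module over the enveloping algebra. -/
noncomputable instance instModuleEnvelopingAlgebra : Module (EnvelopingAlgebra k Λ) Λ :=
  TensorProduct.Algebra.module

variable {k Λ} in
theorem EnvelopingAlgebra.tmul_smul (a : Λ) (b : Λᵐᵒᵖ) (x : Λ) :
    (a ⊗ₜ[k] b : EnvelopingAlgebra k Λ) • x = a * x * b.unop := by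
  rw [TensorProduct.Algebra.smul_def, MulOpposite.smul_eq_mul_unop, smul_eq_mul, mul_assoc]

/-- The regular bimodule is generated by `1`. -/
instance instFiniteEnvelopingAlgebra : Module.Finite (EnvelopingAlgebra k Λ) Λ := by
  refine Module.Finite.of_surjective
    (LinearMap.toSpanSingleton (EnvelopingAlgebra k Λ) Λ 1) fun x ↦ ⟨x ⊗ₜ 1, ?_⟩
  rw [LinearMap.toSpanSingleton_apply, EnvelopingAlgebra.tmul_smul]
  simp

/-- The enveloping algebra of a finite-dimensional algebra is finite-dimensional, so artinian. -/
instance instIsArtinianRingEnvelopingAlgebra [Module.Finite k Λ] :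
    IsArtinianRing (EnvelopingAlgebra k Λ) :=
  haveI : Module.Finite k Λᵐᵒᵖ := Module.Finite.equiv (MulOpposite.opLinearEquiv k)
  IsArtinianRing.of_finite k _

/-- The regular bimodule `Λ` as an object of the category of finitely generated `Λᵉ`-modules. -/
noncomputable def regularBimodule : FGModuleCat.{u} (EnvelopingAlgebra k Λ) :=
  FGModuleCat.of (EnvelopingAlgebra k Λ) Λ

/-- The algebra `Λ` is `(n, p)`-eventually periodic: so is its regular bimodule over `Λᵉ`. -/
def IsEventuallyPeriodicAlgebra [Module.Finite k Λ] (n p : ℕ) : Prop :=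
  IsEventuallyPeriodicModule n p (regularBimodule k Λ)

end Bimodules

/-!
Write `Λᵉ` for the enveloping algebra, `Ωʲ` for the `j`-th syzygy of the regular bimodule `Λ` over
`Λᵉ`, and `D = Hom_k(-, k)`.

The link between the Gorenstein dimension of `Λ` and the syzygies of `Λ` as a bimodule is the
isomorphism of bimodules `Λᵉ ≅ Hom_k(DΛ, Λ)`, through which `Extⁱ(Λ, Λᵉ)` over `Λᵉ` becomes
`Extⁱ(DΛ, Λ)` over `Λ`. The latter vanishes for `i > d`, and it does not vanish for `i = d`: as
`Λ` has injective dimension `d`, the functor `Extᵈ(-, Λ)` is right exact, and every finitely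
generated module embeds in a power of `DΛ`. Hence `Ext¹(Ωʲ, Λᵉ) = 0` for `j ≥ d`
(`IsGorensteinRingOfDim.extendsFromKer`) whereas `Ext¹(Ωᵈ⁻¹, Λᵉ) ≠ 0` if `d > 0`
(`IsGorensteinRingOfDim.not_extendsFromKer`). If `n < d`, then by periodicity `Ωᵈ⁻¹` would be
isomorphic to some `Ωʲ` with `j ≥ d`, a contradiction; so `d ≤ n`.

The rest takes place over an arbitrary artinian ring `R`. If `Ext¹(X, R)` and `Ext¹(Y, R)` vanish,
a stable isomorphism between `ΩX` and `ΩY` extends to the projective covers and so descends to a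
stable isomorphism between `X` and `Y` (`StablyIsomorphic.of_syzygy`). Therefore `Ωⁿ⁺ᵖ ≅ Ωⁿ`
descends to a stable isomorphism between `Ωᵈ⁺ᵖ` and `Ωᵈ`. The vanishing of `Ext¹(X, R)` also
prevents `ΩX` from having projective summands (`hasNoProjectiveSummand_syzygy`); and, by Fitting's
lemma, a finitely generated module stably isomorphic to a module `Y` of finite length without
projective summands is `Y × Q` with `Q` projective (`StablyIsomorphic.exists_prod_equiv`). This
yields `Ωᵈ⁺ᵖ × Q ≅ Ωᵈ`, with `Q = 0` exactly when `Ωᵈ` has no projective summand. Neither `Ωᵈ⁺¹` nor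
`Ωᵈ⁺¹⁺ᵖ` has one, so these two are isomorphic if `n > d`, and thus `n ≤ d + 1`.

First extension groups are handled without complexes: `Ext¹(N, E) = 0` is expressed as the
extension property `ExtendsFromKer` for a projective presentation of `N`.
-/

/-! ### Extension of maps from the kernel of a presentation -/

section Presentations

variable {R : Type*} [Ring R]

/-- Every linear map `ker π → E` extends to the source `P` of `π : P → N`. For `P` projective and `π`
surjective this says `Ext¹(N, E) = 0`. -/
def ExtendsFromKer {P N : Type*} [AddCommGroup P] [Module R P] [AddCommGroup N] [Module R N]
    (π : P →ₗ[R] N) (E : Type*) [AddCommGroup E] [Module R E] : Prop :=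
  ∀ f : LinearMap.ker π →ₗ[R] E, ∃ g : P →ₗ[R] E, ∀ x : LinearMap.ker π, g x = f x

variable {P N P' N' E E' E'' : Type*} [AddCommGroup P] [Module R P] [AddCommGroup N] [Module R N]
  [AddCommGroup P'] [Module R P'] [AddCommGroup N'] [Module R N'] [AddCommGroup E] [Module R E]
  [AddCommGroup E'] [Module R E'] [AddCommGroup E''] [Module R E'']

theorem LinearMap.exists_comp_eq_of_ker_le {π : P →ₗ[R] N} (hπ : Function.Surjective π)
    (g : P →ₗ[R] E) (hg : LinearMap.ker π ≤ LinearMap.ker g) :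
    ∃ h : N →ₗ[R] E, ∀ x, h (π x) = g x := by
  refine ⟨(LinearMap.ker π).liftQ g hg ∘ₗ (π.quotKerEquivOfSurjective hπ).symm.toLinearMap,
    fun x ↦ ?_⟩
  have : (π.quotKerEquivOfSurjective hπ).symm (π x) = (LinearMap.ker π).mkQ x := by
    rw [LinearEquiv.symm_apply_eq]; rfl
  simp [this]

theorem LinearMap.exists_lift_of_mem_range {i : E →ₗ[R] E'} (hi : Function.Injective i)
    (g : P →ₗ[R] E') (hg : ∀ x, g x ∈ LinearMap.range i) :
    ∃ h : P →ₗ[R] E, ∀ x, i (h x) = g x := by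
  refine ⟨(LinearEquiv.ofInjective i hi).symm.toLinearMap ∘ₗ g.codRestrict _ hg, fun x ↦ ?_⟩
  have := congrArg Subtype.val
    ((LinearEquiv.ofInjective i hi).apply_symm_apply (g.codRestrict _ hg x))
  exact this

namespace ExtendsFromKer

theorem of_equiv_right {π : P →ₗ[R] N} (h : ExtendsFromKer π E) (e : E ≃ₗ[R] E') :
    ExtendsFromKer π E' := fun f ↦ by
  obtain ⟨g, hg⟩ := h (e.symm.toLinearMap ∘ₗ f)
  exact ⟨e.toLinearMap ∘ₗ g, fun x ↦ by simp [hg]⟩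

/-- For projective presentations, the extension property depends only on the presented module. -/
theorem of_equiv {π : P →ₗ[R] N} {π' : P' →ₗ[R] N'} [Module.Projective R P]
    [Module.Projective R P'] (hπ : Function.Surjective π) (hπ' : Function.Surjective π')
    (e : N ≃ₗ[R] N') (h : ExtendsFromKer π E) : ExtendsFromKer π' E := fun f ↦ by
  obtain ⟨α, hα⟩ := Module.projective_lifting_property π' (e.toLinearMap ∘ₗ π) hπ'
  obtain ⟨β, hβ⟩ := Module.projective_lifting_property π (e.symm.toLinearMap ∘ₗ π') hπ
  replace hα : ∀ x, π' (α x) = e (π x) := LinearMap.congr_fun hα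
  replace hβ : ∀ x, π (β x) = e.symm (π' x) := LinearMap.congr_fun hβ
  obtain ⟨g, hg⟩ := h (f ∘ₗ α.restrict (p := LinearMap.ker π) (q := LinearMap.ker π')
    fun x hx ↦ by simp_all)
  let δ : P' →ₗ[R] P' := LinearMap.id - α ∘ₗ β
  have hker : ∀ x, δ x ∈ LinearMap.ker π' := fun x ↦ by simp [δ, hα, hβ]
  refine ⟨g ∘ₗ β + f ∘ₗ δ.codRestrict _ hker, fun x ↦ ?_⟩
  have hx : β x ∈ LinearMap.ker π := by simp [hβ]
  have := hg ⟨β x, hx⟩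
  simp only [LinearMap.coe_comp, Function.comp_apply] at this
  simp only [LinearMap.add_apply, LinearMap.coe_comp, Function.comp_apply, this]
  rw [← map_add]
  congr 1
  ext
  simp [δ]

theorem of_projective {π : P →ₗ[R] N} (h : ExtendsFromKer π R) (Q : Type*) [AddCommGroup Q]
    [Module R Q] [Module.Finite R Q] [Module.Projective R Q] : ExtendsFromKer π Q := fun f ↦ by
  obtain ⟨m, p, hp⟩ := Module.Finite.exists_fin' R Q
  obtain ⟨s, hs⟩ := Module.projective_lifting_property p LinearMap.id hp
  choose g hg using fun i ↦ h (LinearMap.proj i ∘ₗ s ∘ₗ f)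
  refine ⟨p ∘ₗ LinearMap.pi g, fun x ↦ ?_⟩
  have : LinearMap.pi g x = s (f x) := by ext i; simp [hg]
  simp only [LinearMap.comp_apply, this]
  exact LinearMap.congr_fun hs (f x)

variable {P₂ : Type*} [AddCommGroup P₂] [Module R P₂] {π : P →ₗ[R] N}
  {π₂ : P₂ →ₗ[R] LinearMap.ker π} {i : E →ₗ[R] E'} {q : E' →ₗ[R] E''}

/-- Dimension shifting: for a short exact sequence `0 → E → E' → E'' → 0`, if `Ext¹(N, E'') = 0` and
`Ext²(N, E') = 0` then `Ext²(N, E) = 0`. The module `Ext²(N, -)` is read off as `Ext¹` of the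
syzygy `ker π`. -/
theorem left_of_shortExact [Module.Projective R P] (hπ₂ : Function.Surjective π₂)
    (hi : Function.Injective i) (hiq : Function.Exact i q) (hq : Function.Surjective q)
    (h'' : ExtendsFromKer π E'') (h' : ExtendsFromKer π₂ E') : ExtendsFromKer π₂ E := fun f ↦ by
  obtain ⟨g, hg⟩ := h' (i ∘ₗ f)
  obtain ⟨h, hh⟩ := LinearMap.exists_comp_eq_of_ker_le hπ₂ (q ∘ₗ g) fun x hx ↦ by
    simpa [hiq.apply_apply_eq_zero] using congrArg q (hg ⟨x, hx⟩)
  obtain ⟨h', hh'⟩ := h'' h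
  obtain ⟨l, hl⟩ := Module.projective_lifting_property q h' hq
  replace hl : ∀ x, q (l x) = h' x := LinearMap.congr_fun hl
  obtain ⟨r, hr⟩ := LinearMap.exists_lift_of_mem_range hi
    (g - l ∘ₗ (LinearMap.ker π).subtype ∘ₗ π₂) fun x ↦ by
      refine (hiq _).1 ?_
      have := hh x
      simp_all
  refine ⟨r, fun x ↦ hi ?_⟩
  have hx : π₂ x = 0 := x.2
  simp [hr, hg, hx]

/-- If `Ext¹(N, E) = 0`, then `Hom(N, E') → Hom(N, E'')` is surjective. -/
theorem exists_lift [Module.Projective R P] (hπ : Function.Surjective π)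
    (hi : Function.Injective i) (hiq : Function.Exact i q) (hq : Function.Surjective q)
    (h : ExtendsFromKer π E) (f : N →ₗ[R] E'') : ∃ t : N →ₗ[R] E', ∀ x, q (t x) = f x := by
  obtain ⟨l, hl⟩ := Module.projective_lifting_property q (f ∘ₗ π) hq
  replace hl : ∀ x, q (l x) = f (π x) := LinearMap.congr_fun hl
  obtain ⟨r, hr⟩ := LinearMap.exists_lift_of_mem_range hi
    (l ∘ₗ (LinearMap.ker π).subtype) fun x ↦ by
      refine (hiq _).1 ?_
      have hx : π x = 0 := x.2
      simp [hl, hx]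
  obtain ⟨g, hg⟩ := h r
  obtain ⟨t, ht⟩ := LinearMap.exists_comp_eq_of_ker_le hπ (l - i ∘ₗ g) fun x hx ↦ by
    have h1 := hg ⟨x, hx⟩
    have h2 := hr ⟨x, hx⟩
    simp_all
  refine ⟨t, fun x ↦ ?_⟩
  obtain ⟨y, rfl⟩ := hπ x
  simp [ht, hl, hiq.apply_apply_eq_zero]

/-- Dimension shifting: for a short exact sequence `0 → E → E' → E'' → 0`, if `Ext¹(N, E') = 0` and
`Ext²(N, E) = 0` then `Ext¹(N, E'') = 0`. -/
theorem right_of_shortExact [Module.Projective R P₂] (hπ₂ : Function.Surjective π₂)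
    (hi : Function.Injective i) (hiq : Function.Exact i q) (hq : Function.Surjective q)
    (h' : ExtendsFromKer π E') (h : ExtendsFromKer π₂ E) : ExtendsFromKer π E'' := fun f ↦ by
  obtain ⟨t, ht⟩ := h.exists_lift hπ₂ hi hiq hq f
  obtain ⟨t', ht'⟩ := h' t
  exact ⟨q ∘ₗ t', fun x ↦ by simp [ht', ht]⟩

end ExtendsFromKer

end Presentations

/-! ### Projective covers -/

section ProjectiveCovers

variable {R : Type*} [Ring R] {P N P' N' : Type*} [AddCommGroup P] [Module R P] [AddCommGroup N]
  [Module R N] [AddCommGroup P'] [Module R P'] [AddCommGroup N'] [Module R N']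

/-- Projective covers are unique up to isomorphism, and so are their kernels. -/
theorem IsProjectiveCover.nonempty_ker_equiv {π : P →ₗ[R] N} {π' : P' →ₗ[R] N'}
    (h : IsProjectiveCover π) (h' : IsProjectiveCover π') (e : N ≃ₗ[R] N') :
    Nonempty (LinearMap.ker π ≃ₗ[R] LinearMap.ker π') := by
  have := h.projective
  have := h'.projective
  obtain ⟨α, hα⟩ := Module.projective_lifting_property π' (e.toLinearMap ∘ₗ π) h'.surjective
  replace hα : ∀ x, π' (α x) = e (π x) := LinearMap.congr_fun hα
  have hαs : Function.Surjective α := by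
    rw [← LinearMap.range_eq_top]
    refine h'.superfluous _ (eq_top_iff.2 fun y _ ↦ ?_)
    obtain ⟨x, hx⟩ := h.surjective (e.symm (π' y))
    exact Submodule.mem_sup.2 ⟨α x, ⟨x, rfl⟩, y - α x, by simp [hα, hx], by simp⟩
  obtain ⟨s, hs⟩ := Module.projective_lifting_property α LinearMap.id hαs
  replace hs : ∀ x, α (s x) = x := LinearMap.congr_fun hs
  have hss : LinearMap.range s = ⊤ := by
    refine h.superfluous _ (eq_top_iff.2 fun x _ ↦ ?_)
    refine Submodule.mem_sup.2 ⟨s (α x), ⟨_, rfl⟩, x - s (α x), ?_, by simp⟩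
    rw [LinearMap.mem_ker, ← e.map_eq_zero_iff, ← hα, map_sub, hs, sub_self, map_zero]
  have hαi : Function.Injective α := by
    intro x y hxy
    obtain ⟨x, rfl⟩ := LinearMap.range_eq_top.1 hss x
    obtain ⟨y, rfl⟩ := LinearMap.range_eq_top.1 hss y
    rw [hs, hs] at hxy
    rw [hxy]
  let ε := LinearEquiv.ofBijective α ⟨hαi, hαs⟩
  refine ⟨ε.ofSubmodules _ _ ?_⟩
  ext y
  obtain ⟨x, rfl⟩ := ε.surjective y
  have : π' (ε x) = e (π x) := hα x
  simp [this]

/-- If `Ext¹(N, R) = 0`, the projection of a syzygy of `N` onto a projective summand `Q` extends to the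
projective cover; its kernel and `Q` span the cover, so `Q = 0` since the syzygy is superfluous. -/
theorem IsProjectiveCover.hasNoProjectiveSummand_ker [IsNoetherianRing R] [Module.Finite R P]
    {π : P →ₗ[R] N} (h : IsProjectiveCover π) (hE : ExtendsFromKer π R) :
    HasNoProjectiveSummand R (LinearMap.ker π) := by
  intro Q C hQC hQ
  obtain ⟨g, hg⟩ := hE.of_projective Q (Q.projectionOnto C hQC)
  have hgQ : ∀ x : Q, g (x : LinearMap.ker π) = x := fun x ↦ by simp [hg]
  -- the kernel of the retraction is a proper complement of `Q` unless `Q` vanishes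
  have htop : LinearMap.ker g = ⊤ := by
    refine h.superfluous _ (eq_top_iff.2 fun x _ ↦ ?_)
    exact Submodule.mem_sup.2 ⟨x - (g x : LinearMap.ker π), by simp [hgQ],
      (g x : LinearMap.ker π), (g x : LinearMap.ker π).2, by simp⟩
  refine (Submodule.eq_bot_iff _).2 fun x hx ↦ ?_
  have h1 := hgQ ⟨x, hx⟩
  have h2 : (x : P) ∈ LinearMap.ker g := by rw [htop]; trivial
  rw [LinearMap.mem_ker] at h2
  rw [h2] at h1
  exact (congrArg Subtype.val h1).symm

end ProjectiveCovers

/-! ### Stable isomorphisms -/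

section StableIsomorphism

variable {R : Type u} [Ring R]

/-- `g ∘ f` is the identity of `X` up to a map that factors through a finitely generated projective
module. This is a one-sided condition: `f` is split by `g` in the stable category. -/
def StablyInverse {X Y : Type*} [AddCommGroup X] [Module R X] [AddCommGroup Y] [Module R Y]
    (f : X →ₗ[R] Y) (g : Y →ₗ[R] X) : Prop :=
  ∃ (P : FGModuleCat.{u} R) (a : X →ₗ[R] P) (b : P →ₗ[R] X), Module.Projective R P ∧
    ∀ x, g (f x) = x + b (a x)

/-- `X` and `Y` are isomorphic in the category of modules modulo the maps that factor through finitely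
generated projective modules. -/
def StablyIsomorphic (R : Type u) [Ring R] (X Y : Type*) [AddCommGroup X] [Module R X]
    [AddCommGroup Y] [Module R Y] : Prop :=
  ∃ (f : X →ₗ[R] Y) (g : Y →ₗ[R] X), StablyInverse f g ∧ StablyInverse g f

variable {X Y : Type*} [AddCommGroup X] [Module R X] [AddCommGroup Y] [Module R Y]

theorem StablyIsomorphic.of_equiv (e : X ≃ₗ[R] Y) : StablyIsomorphic R X Y :=
  have h : Module.Projective R (FGModuleCat.of R PUnit.{u + 1}) :=
    inferInstanceAs (Module.Projective R PUnit.{u + 1})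
  ⟨e.toLinearMap, e.symm.toLinearMap, ⟨FGModuleCat.of R PUnit.{u + 1}, 0, 0, h, by simp⟩,
    ⟨FGModuleCat.of R PUnit.{u + 1}, 0, 0, h, by simp⟩⟩

/-- If `g ∘ f - 1` on the syzygy is `b ∘ a`, with `a` and `b` passing through a projective module, and
`a'` extends `a` to `P`, then `β ∘ α - 1 - b ∘ a'` vanishes on the syzygy and so factors as `γ ∘ π`;
hence `g' ∘ f' - 1 = π ∘ γ`. -/
theorem StablyInverse.of_ker {P Q : FGModuleCat.{u} R} [Module.Projective R P]
    {π : P →ₗ[R] X} {ρ : Q →ₗ[R] Y} (hπ : Function.Surjective π)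
    (hE : ExtendsFromKer π R)
    {f : LinearMap.ker π →ₗ[R] LinearMap.ker ρ} {g : LinearMap.ker ρ →ₗ[R] LinearMap.ker π}
    (h : StablyInverse f g) {α : P →ₗ[R] Q} {β : Q →ₗ[R] P}
    (hα : ∀ x : LinearMap.ker π, α x = f x) (hβ : ∀ y : LinearMap.ker ρ, β y = g y)
    {f' : X →ₗ[R] Y} {g' : Y →ₗ[R] X} (hf' : ∀ x, f' (π x) = ρ (α x))
    (hg' : ∀ y, g' (ρ y) = π (β y)) : StablyInverse f' g' := by
  obtain ⟨T, a, b, hT, hab⟩ := h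
  obtain ⟨a', ha'⟩ := hE.of_projective T a
  obtain ⟨γ, hγ⟩ := LinearMap.exists_comp_eq_of_ker_le hπ
    (β ∘ₗ α - LinearMap.id - (LinearMap.ker π).subtype ∘ₗ b ∘ₗ a') fun x hx ↦ by
      have h1 := hα ⟨x, hx⟩
      have h2 := ha' ⟨x, hx⟩
      have h3 := hab ⟨x, hx⟩
      have h4 := hβ (f ⟨x, hx⟩)
      simp only at h1 h2
      simp [h1, h2, h3, h4]
  refine ⟨P, γ, π, inferInstance, fun x ↦ ?_⟩
  obtain ⟨y, rfl⟩ := hπ x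
  have : π (b (a' y)) = 0 := (b (a' y)).2
  rw [hf', hg', hγ]
  simp [this]

/-- A stable isomorphism between syzygies of `X` and `Y` descends to `X` and `Y` when `Ext¹(X, R)` and
`Ext¹(Y, R)` vanish. -/
theorem StablyIsomorphic.of_ker {P Q : FGModuleCat.{u} R} [Module.Projective R P]
    [Module.Projective R Q] {π : P →ₗ[R] X} {ρ : Q →ₗ[R] Y} (hπ : Function.Surjective π)
    (hρ : Function.Surjective ρ) (hE : ExtendsFromKer π R) (hE' : ExtendsFromKer ρ R)
    (h : StablyIsomorphic R (LinearMap.ker π) (LinearMap.ker ρ)) : StablyIsomorphic R X Y := by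
  obtain ⟨f, g, hfg, hgf⟩ := h
  obtain ⟨α, hα⟩ := hE.of_projective Q ((LinearMap.ker ρ).subtype ∘ₗ f)
  obtain ⟨β, hβ⟩ := hE'.of_projective P ((LinearMap.ker π).subtype ∘ₗ g)
  obtain ⟨f', hf'⟩ := LinearMap.exists_comp_eq_of_ker_le hπ (ρ ∘ₗ α) fun x hx ↦ by
    have := hα ⟨x, hx⟩
    simp only at this
    simp [this]
  obtain ⟨g', hg'⟩ := LinearMap.exists_comp_eq_of_ker_le hρ (π ∘ₗ β) fun x hx ↦ by
    have := hβ ⟨x, hx⟩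
    simp only at this
    simp [this]
  exact ⟨f', g', hfg.of_ker hπ hE hα hβ hf' hg', hgf.of_ker hρ hE' hβ hα hg' hf'⟩

theorem HasNoProjectiveSummand.subsingleton_of_retract (h : HasNoProjectiveSummand R X)
    {Q : Type*} [AddCommGroup Q] [Module R Q] [Module.Projective R Q] {i : Q →ₗ[R] X}
    {r : X →ₗ[R] Q} (hr : ∀ x, r (i x) = x) : Subsingleton Q := by
  have hi : Function.Injective i := Function.LeftInverse.injective hr
  have hbot := h (LinearMap.range i) (LinearMap.ker r)
    (LinearMap.isCompl_of_proj (f := (LinearEquiv.ofInjective i hi).toLinearMap ∘ₗ r)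
      (by rintro ⟨_, x, rfl⟩; ext; simp [hr]) |> fun t ↦ by simpa using t)
    (Module.Projective.of_equiv (LinearEquiv.ofInjective i hi))
  rw [LinearMap.range_eq_bot] at hbot
  exact ⟨fun x y ↦ hi (by simp [hbot])⟩

theorem HasNoProjectiveSummand.nonempty_equiv_of_prod {Q : Type*} [AddCommGroup Q]
    [Module R Q] [Module.Projective R Q] (h : HasNoProjectiveSummand R X) (e : (Y × Q) ≃ₗ[R] X) :
    Nonempty (Y ≃ₗ[R] X) := by
  have := h.subsingleton_of_retract (i := e.toLinearMap ∘ₗ LinearMap.inr R Y Q)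
    (r := LinearMap.snd R Y Q ∘ₗ e.symm.toLinearMap) (by simp)
  have : Unique Q := uniqueOfSubsingleton 0
  exact ⟨(LinearEquiv.prodUnique (R := R) (M := Y) (M₂ := Q)).symm.trans e⟩

theorem HasNoProjectiveSummand.congr (h : HasNoProjectiveSummand R X) (e : X ≃ₗ[R] Y) :
    HasNoProjectiveSummand R Y := by
  intro Q N hQN hQ
  have := h.subsingleton_of_retract (i := e.symm.toLinearMap ∘ₗ Q.subtype)
    (r := Q.projectionOnto N hQN ∘ₗ e.toLinearMap) (by simp)
  exact Submodule.subsingleton_iff_eq_bot.1 this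

/-- By Fitting's lemma, `P` is the sum of the kernel and the range of a power of `a ∘ b`. The range is
projective, and `a ∘ b` is bijective on it, so it is a retract of `X`; thus it is zero. -/
theorem HasNoProjectiveSummand.isNilpotent_comp (h : HasNoProjectiveSummand R X)
    {P : Type*} [AddCommGroup P] [Module R P] [Module.Projective R P] [IsNoetherian R P]
    [IsArtinian R P] (a : X →ₗ[R] P) (b : P →ₗ[R] X) : IsNilpotent (a ∘ₗ b : Module.End R P) := by
  let φ : Module.End R P := a ∘ₗ b
  obtain ⟨N, hN⟩ := Filter.eventually_atTop.1 φ.eventually_isCompl_ker_pow_range_pow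
  have hc := hN (N + 1) (by omega)
  let Q := LinearMap.range (φ ^ (N + 1))
  let r := Q.projectionOnto _ hc.symm
  have hQ : Module.Projective R Q := Module.Projective.of_split Q.subtype r (by ext; simp [r])
  let ψ : Module.End R Q := (φ ^ (N + 1)).restrict fun x _ ↦ ⟨x, rfl⟩
  have hψ : Function.Injective ψ := by
    rw [injective_iff_map_eq_zero]
    intro x hx
    have h0 : (x : P) ∈ LinearMap.ker (φ ^ (N + 1)) := congrArg Subtype.val hx
    exact Subtype.ext (Submodule.disjoint_def.1 hc.disjoint _ h0 x.2)
  let ε := LinearEquiv.ofBijective ψ (IsArtinian.bijective_of_injective_endomorphism ψ hψ)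
  have := h.subsingleton_of_retract (i := b ∘ₗ Q.subtype)
    (r := ε.symm.toLinearMap ∘ₗ r ∘ₗ (φ ^ N) ∘ₗ a) fun x ↦ by
      have h1 : (φ ^ N) (a (b x)) = ψ x := by
        change (φ ^ N * φ) x = (φ ^ (N + 1)) x
        rw [pow_succ]
      have h2 : r (ψ x) = ψ x := by simp [r]
      simp only [LinearMap.coe_comp, Function.comp_apply, Submodule.coe_subtype, h1, h2]
      exact ε.symm_apply_apply x
  refine ⟨N + 1, LinearMap.range_eq_bot.1 ?_⟩
  exact Submodule.subsingleton_iff_eq_bot.1 this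

/-- The composite `f ∘ g` of the stable isomorphisms is `1` plus a nilpotent map, so `Y` is a summand
of `X` with complement `ker f`, where `1 = 1 - g ∘ f` factors through a projective module. -/
theorem StablyIsomorphic.exists_prod_equiv [IsArtinianRing R] {X Y : FGModuleCat.{u} R}
    (h : StablyIsomorphic R X Y) (hY : HasNoProjectiveSummand R Y) :
    ∃ Q : FGModuleCat.{u} R, Module.Projective R Q ∧ Nonempty ((Y × Q) ≃ₗ[R] X) := by
  obtain ⟨f, g, ⟨P, a, b, hP, hab⟩, ⟨P', a', b', hP', hab'⟩⟩ := h
  have hnil : IsNilpotent (b' ∘ₗ a' : Module.End R Y) := by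
    obtain ⟨m, hm⟩ := hY.isNilpotent_comp a' b'
    refine ⟨m + 1, ?_⟩
    have : ∀ i : ℕ, (b' ∘ₗ a' : Module.End R Y) ^ (i + 1) =
        b' ∘ₗ ((a' ∘ₗ b' : Module.End R P') ^ i) ∘ₗ a' := by
      intro i
      induction i with
      | zero => ext; simp
      | succ i ih => rw [pow_succ, ih, pow_succ]; rfl
    rw [this, hm]
    ext
    simp
  obtain ⟨v, hv⟩ := hnil.isUnit_one_add
  let s : Y →ₗ[R] X := g ∘ₗ (v⁻¹ : (Module.End R Y)ˣ).val
  have hs : ∀ y, f (s y) = y := fun y ↦ by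
    have h1 := LinearMap.congr_fun v.mul_inv y
    rw [hv] at h1
    exact (hab' _).trans h1
  let t : X →ₗ[R] LinearMap.ker f :=
    (LinearMap.id - s ∘ₗ f : X →ₗ[R] X).codRestrict _ fun x ↦ by simp [hs]
  have ht : ∀ x : LinearMap.ker f, t x = x := fun x ↦ by ext; simp [t]
  refine ⟨FGModuleCat.of R (LinearMap.ker f), ?_, ⟨?_⟩⟩
  · refine Module.Projective.of_split (M := P) (a ∘ₗ (LinearMap.ker f).subtype) (-(t ∘ₗ b)) ?_
    refine LinearMap.ext fun x ↦ ?_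
    have h1 := hab x
    rw [LinearMap.mem_ker.1 x.2, map_zero] at h1
    have h2 : b (a x) = -(x : X) := (neg_eq_of_add_eq_zero_right h1.symm).symm
    simp [h2, ht]
  · refine LinearEquiv.ofLinearMap (s.coprod (LinearMap.ker f).subtype) (f.prod t) ?_ ?_
    · ext x; simp [t]
    · ext x
      · simp [hs]
      · simp [t, hs]
      · simp
      · simp [t]
end StableIsomorphism

/-! ### Iterated syzygies over an artinian ring -/

section IteratedSyzygies

variable {R : Type u} [Ring R] [IsArtinianRing R] {M N : FGModuleCat.{u} R}

theorem iteratedSyzygy_iteratedSyzygy (M : FGModuleCat.{u} R) (n m : ℕ) :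
    iteratedSyzygy m (iteratedSyzygy n M) = iteratedSyzygy (n + m) M := by
  induction m with
  | zero => rfl
  | succ m ih => exact congrArg syzygy ih

theorem nonempty_syzygy_equiv (h : Nonempty (M ≃ₗ[R] N)) :
    Nonempty (syzygy M ≃ₗ[R] syzygy N) :=
  (isProjectiveCover_projectiveCoverπ M).nonempty_ker_equiv
    (isProjectiveCover_projectiveCoverπ N) h.some

theorem nonempty_iteratedSyzygy_equiv {a b : ℕ}
    (h : Nonempty (iteratedSyzygy a M ≃ₗ[R] iteratedSyzygy b M)) (m : ℕ) :
    Nonempty (iteratedSyzygy (a + m) M ≃ₗ[R] iteratedSyzygy (b + m) M) := by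
  induction m with
  | zero => exact h
  | succ m ih => exact nonempty_syzygy_equiv ih

theorem nonempty_iteratedSyzygy_equiv_add_mul {n p : ℕ}
    (h : Nonempty (iteratedSyzygy (n + p) M ≃ₗ[R] iteratedSyzygy n M)) (m : ℕ) :
    Nonempty (iteratedSyzygy (n + m * p) M ≃ₗ[R] iteratedSyzygy n M) := by
  induction m with
  | zero =>
    rw [zero_mul, add_zero]
    exact ⟨LinearEquiv.refl R _⟩
  | succ m ih =>
    obtain ⟨e⟩ := nonempty_iteratedSyzygy_equiv h (m * p)
    rw [show n + (m + 1) * p = n + p + m * p by ring]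
    exact ⟨e.trans ih.some⟩

theorem extendsFromKer_congr {E : Type*} [AddCommGroup E] [Module R E]
    (h : ExtendsFromKer (projectiveCoverπ M) E) (e : M ≃ₗ[R] N) :
    ExtendsFromKer (projectiveCoverπ N) E :=
  have := (isProjectiveCover_projectiveCoverπ M).projective
  have := (isProjectiveCover_projectiveCoverπ N).projective
  h.of_equiv (isProjectiveCover_projectiveCoverπ M).surjective
    (isProjectiveCover_projectiveCoverπ N).surjective e

theorem hasNoProjectiveSummand_syzygy (h : ExtendsFromKer (projectiveCoverπ M) R) :
    HasNoProjectiveSummand R (syzygy M) :=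
  (isProjectiveCover_projectiveCoverπ M).hasNoProjectiveSummand_ker h

theorem StablyIsomorphic.of_syzygy (hM : ExtendsFromKer (projectiveCoverπ M) R)
    (hN : ExtendsFromKer (projectiveCoverπ N) R)
    (h : StablyIsomorphic R (syzygy M) (syzygy N)) : StablyIsomorphic R M N :=
  have := (isProjectiveCover_projectiveCoverπ M).projective
  have := (isProjectiveCover_projectiveCoverπ N).projective
  .of_ker (isProjectiveCover_projectiveCoverπ M).surjective
    (isProjectiveCover_projectiveCoverπ N).surjective hM hN h

/-- An isomorphism between high syzygies descends, up to projective summands, as far down as `Ext¹`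
into `R` vanishes. -/
theorem StablyIsomorphic.of_iteratedSyzygy {a p m : ℕ}
    (hE : ∀ j, a ≤ j → ExtendsFromKer (projectiveCoverπ (iteratedSyzygy j M)) R)
    (h : Nonempty (iteratedSyzygy (a + m + p) M ≃ₗ[R] iteratedSyzygy (a + m) M)) :
    StablyIsomorphic R (iteratedSyzygy a M) (iteratedSyzygy (a + p) M) := by
  induction m generalizing a with
  | zero => exact .of_equiv h.some.symm
  | succ m ih =>
    refine .of_syzygy (hE _ le_rfl) (hE _ (by omega)) ?_
    have := ih (a := a + 1) (fun j hj ↦ hE j (by omega))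
      (by rwa [show a + 1 + m = a + (m + 1) by omega])
    rwa [show a + 1 + p = a + p + 1 by omega] at this

theorem exists_iteratedSyzygy_prod_equiv {a p m : ℕ} (hp : 0 < p)
    (hE : ∀ j, a ≤ j → ExtendsFromKer (projectiveCoverπ (iteratedSyzygy j M)) R)
    (h : Nonempty (iteratedSyzygy (a + m + p) M ≃ₗ[R] iteratedSyzygy (a + m) M)) :
    ∃ Q : FGModuleCat.{u} R, Module.Projective R Q ∧
      Nonempty ((iteratedSyzygy (a + p) M × Q) ≃ₗ[R] iteratedSyzygy a M) := by
  refine (StablyIsomorphic.of_iteratedSyzygy hE h).exists_prod_equiv ?_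
  obtain ⟨p, rfl⟩ := Nat.exists_eq_succ_of_ne_zero hp.ne'
  exact hasNoProjectiveSummand_syzygy (hE (a + p) (by omega))

theorem hasNoProjectiveSummand_iteratedSyzygy_iff {a p m : ℕ} (hp : 0 < p)
    (hE : ∀ j, a ≤ j → ExtendsFromKer (projectiveCoverπ (iteratedSyzygy j M)) R)
    (h : Nonempty (iteratedSyzygy (a + m + p) M ≃ₗ[R] iteratedSyzygy (a + m) M)) :
    HasNoProjectiveSummand R (iteratedSyzygy a M) ↔
      Nonempty (iteratedSyzygy (a + p) M ≃ₗ[R] iteratedSyzygy a M) := by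
  constructor
  · intro hs
    obtain ⟨Q, hQ, ⟨e⟩⟩ := exists_iteratedSyzygy_prod_equiv hp hE h
    exact hs.nonempty_equiv_of_prod e
  · rintro ⟨e⟩
    obtain ⟨p, rfl⟩ := Nat.exists_eq_succ_of_ne_zero hp.ne'
    exact (hasNoProjectiveSummand_syzygy (hE (a + p) (by omega))).congr e

end IteratedSyzygies

/-! ### Projectivity after restriction of scalars -/

section Restriction

theorem Module.Projective.restrictScalars_of_projective (S R P : Type*) [Ring S] [Ring R]
    [AddCommGroup P] [Module R P] [Module S R] [Module S P] [IsScalarTower S R R]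
    [IsScalarTower S R P] [Module.Projective S R] [Module.Projective R P] :
    Module.Projective S P := by
  obtain ⟨s, hs⟩ := (Module.projective_def' (R := R) (P := P)).1 ‹_›
  classical
  have : Module.Projective S (P →₀ R) :=
    Module.Projective.of_equiv (finsuppLequivDFinsupp (ι := P) (M := R) S).symm
  refine Module.Projective.of_split (s.restrictScalars S)
    ((Finsupp.linearCombination R id).restrictScalars S) ?_
  ext x
  exact LinearMap.congr_fun hs x

variable {S R : Type*} [Ring S] [Ring R]

/-- The `R`-module `N` is projective over `S` after restriction of scalars along `φ : S → R`. -/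
def IsProjectiveAlong (φ : S →+* R) (N : Type*) [AddCommGroup N] [Module R N] : Prop :=
  letI : Module S N := Module.compHom N φ
  Module.Projective S N

variable {φ : S →+* R} {P N : Type*} [AddCommGroup P] [Module R P] [AddCommGroup N] [Module R N]

theorem IsProjectiveAlong.of_projective (h : IsProjectiveAlong φ R) [Module.Projective R P] :
    IsProjectiveAlong φ P := by
  let : Module S R := Module.compHom R φ
  let : Module S P := Module.compHom P φ
  have : IsScalarTower S R R := ⟨fun s x y ↦ mul_assoc (φ s) x y⟩
  have : IsScalarTower S R P := ⟨fun s x y ↦ mul_smul (φ s) x y⟩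
  have : Module.Projective S R := h
  exact Module.Projective.restrictScalars_of_projective S R P

/-- A surjection onto a module that is projective over `S` splits over `S`; the splitting is recorded
as an additive retraction onto the kernel which commutes with the action of `S`. -/
theorem IsProjectiveAlong.exists_retraction (h : IsProjectiveAlong φ N) {π : P →ₗ[R] N}
    (hπ : Function.Surjective π) : ∃ ρ : P →+ LinearMap.ker π,
      (∀ s x, ρ (φ s • x) = φ s • ρ x) ∧ ∀ x : LinearMap.ker π, ρ x = x := by
  let : Module S P := Module.compHom P φ
  let : Module S N := Module.compHom N φ
  have : Module.Projective S N := h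
  let π' : P →ₗ[S] N := { π with map_smul' := fun s x ↦ π.map_smul (φ s) x }
  obtain ⟨s, hs⟩ := Module.projective_lifting_property π' LinearMap.id hπ
  replace hs : ∀ x, π (s x) = x := LinearMap.congr_fun hs
  refine ⟨AddMonoidHom.mk' (fun x ↦ ⟨x - s (π x), by simp [hs]⟩) fun x y ↦ ?_, fun r x ↦ ?_,
    fun x ↦ ?_⟩
  · ext; simp; abel
  · ext
    have : s (φ r • π x) = φ r • s (π x) := s.map_smul r (π x)
    simp [this, smul_sub]
  · ext; simp

theorem IsProjectiveAlong.ker (h : IsProjectiveAlong φ P) (h' : IsProjectiveAlong φ N)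
    {π : P →ₗ[R] N} (hπ : Function.Surjective π) : IsProjectiveAlong φ (LinearMap.ker π) := by
  obtain ⟨ρ, hρ, hρ'⟩ := h'.exists_retraction hπ
  let : Module S P := Module.compHom P φ
  let : Module S (LinearMap.ker π) := Module.compHom _ φ
  have : Module.Projective S P := h
  exact Module.Projective.of_split (M := P)
    (({ toFun := Subtype.val, map_add' := fun _ _ ↦ rfl, map_smul' := fun _ _ ↦ rfl }) :
      LinearMap.ker π →ₗ[S] P)
    ({ ρ with map_smul' := hρ } : P →ₗ[S] LinearMap.ker π) (LinearMap.ext hρ')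

end Restriction

/-! ### Bimodules that are projective on the right -/

section RightModules

variable (k : Type v) (Λ : Type u) [Field k] [Ring Λ] [Algebra k Λ]

/-- The ring homomorphism `b ↦ 1 ⊗ b`, along which a `Λᵉ`-module restricts to a right `Λ`-module. -/
abbrev EnvelopingAlgebra.ofOp : Λᵐᵒᵖ →+* EnvelopingAlgebra k Λ :=
  (Algebra.TensorProduct.includeRight : Λᵐᵒᵖ →ₐ[k] EnvelopingAlgebra k Λ).toRingHom

theorem isProjectiveAlong_ofOp_self :
    IsProjectiveAlong (EnvelopingAlgebra.ofOp k Λ) (EnvelopingAlgebra k Λ) := by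
  let : Module Λᵐᵒᵖ (EnvelopingAlgebra k Λ) := Module.compHom _ (EnvelopingAlgebra.ofOp k Λ)
  have h : Module.Projective Λᵐᵒᵖ (Λᵐᵒᵖ ⊗[k] Λ) := inferInstance
  let e : Λᵐᵒᵖ ⊗[k] Λ ≃ₗ[Λᵐᵒᵖ] EnvelopingAlgebra k Λ :=
    { TensorProduct.comm k Λᵐᵒᵖ Λ with
      map_smul' := fun b x ↦ by
        change TensorProduct.comm k Λᵐᵒᵖ Λ (b • x) =
          (1 ⊗ₜ b : EnvelopingAlgebra k Λ) * (TensorProduct.comm k Λᵐᵒᵖ Λ x)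
        induction x with
        | zero => simp
        | add x y hx hy => rw [smul_add, map_add, map_add, mul_add, hx, hy]
        | tmul x y => simp [TensorProduct.smul_tmul'] }
  exact Module.Projective.of_equiv e

theorem isProjectiveAlong_ofOp_regular : IsProjectiveAlong (EnvelopingAlgebra.ofOp k Λ) Λ := by
  let : Module Λᵐᵒᵖ Λ := Module.compHom _ (EnvelopingAlgebra.ofOp k Λ)
  let e : Λᵐᵒᵖ ≃ₗ[Λᵐᵒᵖ] Λ :=
    { MulOpposite.opAddEquiv.symm with
      map_smul' := fun b x ↦ by
        change (b * x).unop = (1 ⊗ₜ b : EnvelopingAlgebra k Λ) • x.unop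
        simp [EnvelopingAlgebra.tmul_smul] }
  exact Module.Projective.of_equiv e

theorem isProjectiveAlong_ofOp_iteratedSyzygy [Module.Finite k Λ] (j : ℕ) :
    IsProjectiveAlong (EnvelopingAlgebra.ofOp k Λ) (iteratedSyzygy j (regularBimodule k Λ)) := by
  induction j with
  | zero => exact isProjectiveAlong_ofOp_regular k Λ
  | succ j ih =>
    have h := isProjectiveCover_projectiveCoverπ (iteratedSyzygy j (regularBimodule k Λ))
    have := h.projective
    exact ((isProjectiveAlong_ofOp_self k Λ).of_projective).ker ih h.surjective

end RightModules

/-! ### Bimodules of linear maps -/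

section HomBimodule

variable (k : Type*) {Λ : Type*} [Field k] [Ring Λ] [Algebra k Λ]

/-- The `k`-linear maps `W → M` between left `Λ`-modules, as a type of its own so that it can carry
the action of `Λᵉ` given by `((a ⊗ b) • φ) w = a • φ (b • w)`. -/
def HomBimodule (W M : Type*) [AddCommGroup W] [Module k W] [AddCommGroup M] [Module k M] :
    Type _ := W →ₗ[k] M

section
variable (W M : Type*) [AddCommGroup W] [Module k W] [AddCommGroup M] [Module k M]

noncomputable instance : AddCommGroup (HomBimodule k W M) :=
  inferInstanceAs (AddCommGroup (W →ₗ[k] M))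

variable [Module Λ W] [IsScalarTower k Λ W] [Module Λ M] [IsScalarTower k Λ M]

/-- The action of `Λᵉ` on `Hom_k(W, M)`: `Λ` acts through `M`, and `Λᵐᵒᵖ` through `W`. -/
noncomputable def HomBimodule.action : EnvelopingAlgebra k Λ →ₐ[k] Module.End k (W →ₗ[k] M) :=
  haveI : SMulCommClass k Λ M := IsScalarTower.to_smulCommClass
  Algebra.TensorProduct.lift (Algebra.lsmul k k (W →ₗ[k] M))
    (AlgHom.ofLinearMap
      { toFun := fun b ↦ LinearMap.lcomp k M (Algebra.lsmul k k W b.unop)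
        map_add' := fun b c ↦ by ext; simp
        map_smul' := fun b c ↦ by ext; simp }
      (by ext; simp) fun b c ↦ by ext; simp)
    fun a b ↦ by ext; simp

noncomputable instance : Module (EnvelopingAlgebra k Λ) (HomBimodule k W M) :=
  Module.compHom (W →ₗ[k] M) (HomBimodule.action k W M).toRingHom

end
end HomBimodule

/-! ### Linear maps over the enveloping algebra -/

section EnvelopingAlgebra

variable {k : Type*} {Λ : Type*} [Field k] [Ring Λ] [Algebra k Λ] {X Y : Type*} [AddCommGroup X]
  [Module (EnvelopingAlgebra k Λ) X] [AddCommGroup Y] [Module (EnvelopingAlgebra k Λ) Y]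

/-- An additive map between `Λᵉ`-modules that commutes with the pure tensors is linear. -/
def EnvelopingAlgebra.linearMapOfTmul (f : X →+ Y) (hf : ∀ (a : Λ) (b : Λᵐᵒᵖ) (x : X),
    f ((a ⊗ₜ[k] b : EnvelopingAlgebra k Λ) • x) = (a ⊗ₜ[k] b : EnvelopingAlgebra k Λ) • f x) :
    X →ₗ[EnvelopingAlgebra k Λ] Y where
  __ := f
  map_smul' r x := by
    change f (r • x) = r • f x
    induction r using TensorProduct.induction_on with
    | zero =>
      have h1 := zero_smul (EnvelopingAlgebra k Λ) x
      have h2 := zero_smul (EnvelopingAlgebra k Λ) (f x)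
      exact (congrArg f h1).trans (f.map_zero.trans h2.symm)
    | tmul a b => exact hf a b x
    | add r s hr hs =>
      have h1 := add_smul (R := EnvelopingAlgebra k Λ) r s x
      have h2 := add_smul (R := EnvelopingAlgebra k Λ) r s (f x)
      rw [h1, h2, map_add, hr, hs]

end EnvelopingAlgebra

/-! ### Exactness of `Hom_k(W, -)` and injective coefficients -/

section HomBimodule

variable {k : Type*} {Λ : Type*} [Field k] [Ring Λ] [Algebra k Λ]

namespace HomBimodule

variable {W M M' M'' : Type*} [AddCommGroup W] [Module k W] [AddCommGroup M] [Module k M]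
  [AddCommGroup M'] [Module k M'] [AddCommGroup M''] [Module k M'']

instance : FunLike (HomBimodule k W M) W M := inferInstanceAs (FunLike (W →ₗ[k] M) W M)

@[ext] theorem ext {φ ψ : HomBimodule k W M} (h : ∀ w, φ w = ψ w) : φ = ψ := LinearMap.ext h

@[simp] theorem add_apply (φ ψ : HomBimodule k W M) (w : W) : (φ + ψ) w = φ w + ψ w := rfl

variable [Module Λ W] [IsScalarTower k Λ W] [Module Λ M] [IsScalarTower k Λ M]
  [Module Λ M'] [IsScalarTower k Λ M'] [Module Λ M''] [IsScalarTower k Λ M'']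

theorem tmul_smul_apply (a : Λ) (b : Λᵐᵒᵖ) (φ : HomBimodule k W M) (w : W) :
    ((a ⊗ₜ[k] b : EnvelopingAlgebra k Λ) • φ) w = a • φ (b.unop • w) := by
  change (HomBimodule.action k W M (a ⊗ₜ[k] b) (φ : W →ₗ[k] M)) w = _
  simp only [action]
  rfl

variable (k W) in
/-- Postcomposition with a `Λ`-linear map. -/
noncomputable def map (h : M →ₗ[Λ] M') :
    HomBimodule k W M →ₗ[EnvelopingAlgebra k Λ] HomBimodule k W M' :=
  EnvelopingAlgebra.linearMapOfTmul
    (AddMonoidHom.mk' (fun φ ↦ h.restrictScalars k ∘ₗ (φ : W →ₗ[k] M))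
      fun _ _ ↦ LinearMap.comp_add _ _ _) fun a b φ ↦ by
    refine ext fun w ↦ ?_
    rw [tmul_smul_apply]
    change h (((a ⊗ₜ[k] b : EnvelopingAlgebra k Λ) • φ) w) = a • h (φ (b.unop • w))
    rw [tmul_smul_apply, map_smul]

variable {i : M →ₗ[Λ] M'} {q : M' →ₗ[Λ] M''}

theorem map_injective (hi : Function.Injective i) : Function.Injective (map k W i) :=
  fun _ _ h ↦ ext fun w ↦ hi (DFunLike.congr_fun h w)

theorem map_surjective (hq : Function.Surjective q) : Function.Surjective (map k W q) := fun φ ↦ by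
  obtain ⟨l, hl⟩ := Module.projective_lifting_property (q.restrictScalars k)
    (φ : W →ₗ[k] M'') hq
  exact ⟨l, hl⟩

theorem map_exact (hi : Function.Injective i) (hiq : Function.Exact i q) :
    Function.Exact (map k W i) (map k W q) := fun φ ↦ by
  constructor
  · intro h
    obtain ⟨l, hl⟩ := LinearMap.exists_lift_of_mem_range (i := i.restrictScalars k) hi
      (φ : W →ₗ[k] M') fun w ↦ (hiq _).1 (DFunLike.congr_fun h w)
    exact ⟨l, LinearMap.ext hl⟩
  · rintro ⟨φ, rfl⟩
    exact ext fun w ↦ hiq.apply_apply_eq_zero _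

end HomBimodule

/-- If the presentation `π` splits over `Λᵐᵒᵖ` and `I` is injective, then `Ext¹(N, Hom_k(W, I)) = 0`.

Bimodule maps `P → Hom_k(W, I)` are the `Λ`-linear maps `P ⊗_Λ W → I`, and `ker π ⊗_Λ W` embeds into
`P ⊗_Λ W` by the splitting. To avoid tensor products over `Λ`, the map is extended from the
`Λ`-submodule `U` of `P ⊗_ℤ W` spanned by `ker π ⊗ W` and by the relations `x b ⊗ w - x ⊗ b w`.
The additive map `F`, defined on all of `P ⊗_ℤ W` by the retraction `ρ`, is `Λ`-linear on `U` only. -/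
theorem ExtendsFromKer.homBimodule_of_baer {P N W I : Type*} [AddCommGroup P]
    [Module (EnvelopingAlgebra k Λ) P] [AddCommGroup N] [Module (EnvelopingAlgebra k Λ) N]
    [AddCommGroup W] [Module k W] [Module Λ W] [IsScalarTower k Λ W]
    [AddCommGroup I] [Module k I] [Module Λ I] [IsScalarTower k Λ I] (hI : Module.Baer Λ I)
    {π : P →ₗ[EnvelopingAlgebra k Λ] N} (ρ : P →+ LinearMap.ker π)
    (hρ : ∀ (b : Λᵐᵒᵖ) x, ρ ((1 ⊗ₜ[k] b : EnvelopingAlgebra k Λ) • x) =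
      (1 ⊗ₜ[k] b : EnvelopingAlgebra k Λ) • ρ x)
    (hρ' : ∀ x : LinearMap.ker π, ρ x = x) : ExtendsFromKer π (HomBimodule k W I) := fun f ↦ by
  let _ : Module Λ P := Module.compHom P
    (Algebra.TensorProduct.includeLeft : Λ →ₐ[k] EnvelopingAlgebra k Λ).toRingHom
  have hΛ : ∀ (a : Λ) (x : P), a • x = (a ⊗ₜ[k] 1 : EnvelopingAlgebra k Λ) • x := fun _ _ ↦ rfl
  have hcomm : ∀ (a : Λ) (b : Λᵐᵒᵖ) (x : P), a • (1 ⊗ₜ[k] b : EnvelopingAlgebra k Λ) • x =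
      (1 ⊗ₜ[k] b : EnvelopingAlgebra k Λ) • a • x := fun a b x ↦ by
    simp [hΛ, smul_smul]
  let F : P ⊗[ℤ] W →ₗ[ℤ] I := TensorProduct.lift (AddMonoidHom.toIntLinearMap
    (AddMonoidHom.mk' (fun x ↦ (f (ρ x) : W →ₗ[k] I).toAddMonoidHom.toIntLinearMap)
      fun x y ↦ by ext w; rw [map_add, map_add]; rfl))
  have hF : ∀ x w, F (x ⊗ₜ w) = f (ρ x) w := fun _ _ ↦ rfl
  have hrel : ∀ (b : Λᵐᵒᵖ) x w, F (((1 ⊗ₜ[k] b : EnvelopingAlgebra k Λ) • x) ⊗ₜ w) =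
      F (x ⊗ₜ (b.unop • w)) := fun b x w ↦ by
    rw [hF, hF, hρ, map_smul, HomBimodule.tmul_smul_apply, one_smul]
  let S₁ : Set (P ⊗[ℤ] W) := {t | ∃ (x : LinearMap.ker π) (w : W), t = (x : P) ⊗ₜ w}
  let S₂ : Set (P ⊗[ℤ] W) := {t | ∃ (b : Λᵐᵒᵖ) (x : P) (w : W),
    t = ((1 ⊗ₜ[k] b : EnvelopingAlgebra k Λ) • x) ⊗ₜ w - x ⊗ₜ (b.unop • w)}
  let U : Submodule Λ (P ⊗[ℤ] W) := Submodule.span Λ (S₁ ∪ S₂)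
  have hFU : ∀ u ∈ U, ∀ a : Λ, F (a • u) = a • F u := fun u hu ↦ by
    induction hu using Submodule.span_induction with
    | mem t ht =>
      intro a
      rcases ht with ⟨x, w, rfl⟩ | ⟨b, x, w, rfl⟩
      · have h1 : ρ (a • (x : P)) = (a ⊗ₜ[k] 1 : EnvelopingAlgebra k Λ) • x :=
          hρ' ((a ⊗ₜ[k] 1 : EnvelopingAlgebra k Λ) • x)
        rw [TensorProduct.smul_tmul', hF, hF, h1, hρ', map_smul, HomBimodule.tmul_smul_apply]
        simp
      · simp only [smul_sub, TensorProduct.smul_tmul', hcomm, map_sub, hrel, sub_self, smul_zero]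
    | zero => simp
    | add x y _ _ hx hy => intro a; rw [smul_add, map_add, map_add, hx, hy, smul_add]
    | smul c x _ hx => intro a; rw [smul_smul, hx, hx, mul_smul]
  let F' : U →ₗ[Λ] I :=
    { toFun := fun u ↦ F u
      map_add' := fun u v ↦ map_add F _ _
      map_smul' := fun a u ↦ hFU u u.2 a }
  obtain ⟨G, hG⟩ := hI.extension_property U.subtype U.injective_subtype F'
  replace hG : ∀ u ∈ U, G u = F u := fun u hu ↦ LinearMap.congr_fun hG ⟨u, hu⟩
  have hGb : ∀ (b : Λᵐᵒᵖ) x w, G (((1 ⊗ₜ[k] b : EnvelopingAlgebra k Λ) • x) ⊗ₜ w) =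
      G (x ⊗ₜ (b.unop • w)) := fun b x w ↦ by
    rw [← sub_eq_zero, ← map_sub, hG _ (Submodule.subset_span (Or.inr ⟨b, x, w, rfl⟩)), map_sub,
      hrel, sub_self]
  have hGc : ∀ (c : k) (x : P) (w : W), G (x ⊗ₜ (c • w)) = c • G (x ⊗ₜ w) := fun c x w ↦ by
    have h1 := hGb (MulOpposite.op (algebraMap k Λ c)) x w
    have h2 : (1 ⊗ₜ[k] MulOpposite.op (algebraMap k Λ c) : EnvelopingAlgebra k Λ) =
        algebraMap k Λ c ⊗ₜ[k] 1 := by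
      rw [← MulOpposite.algebraMap_apply, Algebra.algebraMap_eq_smul_one,
        Algebra.algebraMap_eq_smul_one, TensorProduct.tmul_smul, TensorProduct.smul_tmul']
    rw [h2, ← hΛ, ← TensorProduct.smul_tmul', map_smul, MulOpposite.unop_op, algebraMap_smul,
      algebraMap_smul] at h1
    exact h1.symm
  let g : P → HomBimodule k W I := fun x ↦
    ({ toFun := fun w ↦ G (x ⊗ₜ w)
       map_add' := fun w w' ↦ by rw [TensorProduct.tmul_add, map_add]
       map_smul' := fun c w ↦ hGc c x w } : W →ₗ[k] I)
  have hg : ∀ x w, g x w = G (x ⊗ₜ w) := fun _ _ ↦ rfl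
  have hgadd : ∀ x y, g (x + y) = g x + g y := fun x y ↦ by
    ext w; simp [hg, TensorProduct.add_tmul]
  refine ⟨EnvelopingAlgebra.linearMapOfTmul (AddMonoidHom.mk' g hgadd) fun a b x ↦ ?_, fun x ↦ ?_⟩
  · have h1 : (a ⊗ₜ[k] b : EnvelopingAlgebra k Λ) • x =
        a • (1 ⊗ₜ[k] b : EnvelopingAlgebra k Λ) • x := by simp [hΛ, smul_smul]
    ext w
    rw [AddMonoidHom.mk'_apply, HomBimodule.tmul_smul_apply, hg, hg, h1,
      ← TensorProduct.smul_tmul', map_smul, hGb]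
  · ext w
    change G ((x : P) ⊗ₜ w) = f x w
    rw [hG _ (Submodule.subset_span (Or.inl ⟨x, w, rfl⟩)), hF, hρ']

end HomBimodule

/-! ### The dual of the regular module -/

section RegularDual

variable (k : Type*) (Λ : Type*) [Field k] [Ring Λ] [Algebra k Λ]

/-- The dual `DΛ = Hom_k(Λ, k)` of the regular right module, as a left module through
`(a • φ) x = φ (x * a)`. -/
def DualModule : Type _ := Λ →ₗ[k] k

namespace DualModule

noncomputable instance : AddCommGroup (DualModule k Λ) := inferInstanceAs (AddCommGroup (Λ →ₗ[k] k))

noncomputable instance : Module k (DualModule k Λ) := inferInstanceAs (Module k (Λ →ₗ[k] k))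

instance : FunLike (DualModule k Λ) Λ k := inferInstanceAs (FunLike (Λ →ₗ[k] k) Λ k)

variable {k Λ}

@[ext] theorem ext {φ ψ : DualModule k Λ} (h : ∀ x, φ x = ψ x) : φ = ψ := LinearMap.ext h

@[simp] theorem add_apply (φ ψ : DualModule k Λ) (x : Λ) : (φ + ψ) x = φ x + ψ x := rfl

@[simp] theorem zero_apply (x : Λ) : (0 : DualModule k Λ) x = 0 := rfl

@[simp] theorem smul_apply (c : k) (φ : DualModule k Λ) (x : Λ) : (c • φ) x = c • φ x := rfl

theorem map_add (φ : DualModule k Λ) (x y : Λ) : φ (x + y) = φ x + φ y := LinearMap.map_add _ _ _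

theorem map_smul (φ : DualModule k Λ) (c : k) (x : Λ) : φ (c • x) = c • φ x :=
  LinearMap.map_smul _ _ _

theorem map_zero (φ : DualModule k Λ) : φ 0 = 0 := LinearMap.map_zero _

noncomputable instance : SMul Λ (DualModule k Λ) :=
  ⟨fun a φ ↦ (φ : Λ →ₗ[k] k) ∘ₗ LinearMap.mulRight k a⟩

@[simp] theorem ring_smul_apply (a : Λ) (φ : DualModule k Λ) (x : Λ) : (a • φ) x = φ (x * a) := rfl

noncomputable instance : Module Λ (DualModule k Λ) where
  one_smul φ := by ext; simp
  mul_smul a b φ := by ext; simp [mul_assoc]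
  smul_zero a := by ext; simp
  smul_add a φ ψ := by ext; simp
  add_smul a b φ := by ext; simp [mul_add, map_add]
  zero_smul φ := by ext; simp [map_zero]

instance : IsScalarTower k Λ (DualModule k Λ) := ⟨fun c a φ ↦ by ext; simp [map_smul]⟩

end DualModule

/-- A finitely generated module embeds in a finite power of `DΛ`: a linear form `ξ` on `X` gives the
`Λ`-linear map `x ↦ (a ↦ ξ (a • x))`. -/
theorem exists_injective_pi_dualModule [Module.Finite k Λ] (X : Type*) [AddCommGroup X]
    [Module Λ X] [Module.Finite Λ X] :
    ∃ (m : ℕ) (j : X →ₗ[Λ] (Fin m → DualModule k Λ)), Function.Injective j := by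
  let _ : Module k X := Module.compHom X (algebraMap k Λ)
  have : IsScalarTower k Λ X := .of_algebraMap_smul fun _ _ ↦ rfl
  have : Module.Finite k X := Module.Finite.trans Λ X
  let b := Module.finBasis k X
  refine ⟨Module.finrank k X,
    { toFun := fun x i ↦ (b.coord i ∘ₗ (LinearMap.toSpanSingleton Λ X x).restrictScalars k :
        Λ →ₗ[k] k)
      map_add' := fun x y ↦ by
        ext i a
        exact (congrArg (b.coord i) (smul_add a x y)).trans (_root_.map_add _ _ _)
      map_smul' := fun c x ↦ by
        ext i a
        exact congrArg (b.coord i) (smul_smul a c x) }, fun x y hxy ↦ ?_⟩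
  refine b.ext_elem fun i ↦ ?_
  have h : b.coord i ((1 : Λ) • x) = b.coord i ((1 : Λ) • y) :=
    DFunLike.congr_fun (congrFun hxy i) 1
  simpa using h

/-- `Λᵉ ≅ Hom_k(DΛ, Λ)` as bimodules: `a ⊗ b` corresponds to `φ ↦ φ(b) • a`. -/
theorem nonempty_homBimodule_dualModule_equiv [Module.Finite k Λ] :
    Nonempty (HomBimodule k (DualModule k Λ) Λ ≃ₗ[EnvelopingAlgebra k Λ]
      EnvelopingAlgebra k Λ) := by
  let ev : HomBimodule k (DualModule k Λ) Λ :=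
    (LinearMap.toSpanSingleton k Λ 1 ∘ₗ LinearMap.applyₗ (1 : Λ) : (Λ →ₗ[k] k) →ₗ[k] Λ)
  have hev : ∀ φ, ev φ = φ 1 • (1 : Λ) := fun _ ↦ rfl
  let F := LinearMap.toSpanSingleton (EnvelopingAlgebra k Λ) (HomBimodule k (DualModule k Λ) Λ) ev
  have hF : ∀ a b φ, F (a ⊗ₜ b) φ = φ b.unop • a := fun a b φ ↦ by
    simp [F, HomBimodule.tmul_smul_apply, hev]
  have hfin : Module.Finite k Λᵐᵒᵖ := Module.Finite.equiv (MulOpposite.opLinearEquiv k)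
  let e : Λ ⊗[k] Λᵐᵒᵖ ≃ₗ[k] ((Λ →ₗ[k] k) →ₗ[k] Λ) :=
    TensorProduct.comm k Λ Λᵐᵒᵖ ≪≫ₗ TensorProduct.congr
      ((MulOpposite.opLinearEquiv k).symm ≪≫ₗ Module.evalEquiv k Λ) (LinearEquiv.refl k Λ) ≪≫ₗ
      dualTensorHomEquiv k (Module.Dual k Λ) Λ
  have he : ∀ t, F t = e t := fun t ↦ by
    induction t using TensorProduct.induction_on with
    | zero => rw [_root_.map_zero, _root_.map_zero]; rfl
    | add x y hx hy => rw [_root_.map_add, _root_.map_add, hx, hy]; rfl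
    | tmul a b =>
      refine HomBimodule.ext fun φ ↦ ?_
      rw [hF]
      change _ = (e (a ⊗ₜ b)) φ
      simp [e]
      rfl
  exact ⟨(LinearEquiv.ofBijective F
    ⟨fun x y h ↦ e.injective (by rw [he, he] at h; exact h),
      fun y ↦ ⟨e.symm y, (he _).trans (e.apply_symm_apply y)⟩⟩).symm⟩

end RegularDual

/-! ### Injective dimension and extensions of the regular bimodule -/

section InjectiveDimension

/-- The first step `0 → M → I → J → 0` of an injective resolution of `M`. -/
theorem exists_baer_shortExact {Λ : Type u} [Ring Λ] (M : Type u) [AddCommGroup M] [Module Λ M] :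
    ∃ (I J : ModuleCat.{u} Λ) (i : M →ₗ[Λ] I) (q : I →ₗ[Λ] J), Function.Injective i ∧
      Function.Exact i q ∧ Function.Surjective q ∧ Module.Baer Λ I ∧
      ∀ d, HasInjectiveDimensionLT (ModuleCat.of Λ M) (d + 2) ↔
        HasInjectiveDimensionLT J (d + 1) := by
  let I := Injective.under (ModuleCat.of Λ M)
  have hI : Injective I := inferInstanceAs (Injective (Injective.under (ModuleCat.of Λ M)))
  let i : M →ₗ[Λ] I := (Injective.ι (ModuleCat.of Λ M)).hom
  have hi : Function.Injective i := (ModuleCat.mono_iff_injective _).1 inferInstance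
  let q : I →ₗ[Λ] (I ⧸ LinearMap.range i) := (LinearMap.range i).mkQ
  have hiq : Function.Exact i q := LinearMap.exact_iff.2 (Submodule.ker_mkQ _)
  have hq : Function.Surjective q := Submodule.mkQ_surjective _
  let S : ShortComplex (ModuleCat.{u} Λ) := ShortComplex.mk (X₁ := ModuleCat.of Λ M) (X₂ := I)
    (X₃ := ModuleCat.of Λ (I ⧸ LinearMap.range i)) (ModuleCat.ofHom i) (ModuleCat.ofHom q)
    (by ext x; exact hiq.apply_apply_eq_zero x)
  have hS : S.ShortExact :=
    { exact := (ShortComplex.ShortExact.moduleCat_exact_iff_function_exact S).2 hiq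
      mono_f := (ModuleCat.mono_iff_injective _).2 hi
      epi_g := (ModuleCat.epi_iff_surjective _).2 hq }
  exact ⟨I, _, i, q, hi, hiq, hq,
    Module.Baer.of_injective ((Module.injective_iff_injective_object Λ I).2 hI),
    fun d ↦ (hS.hasInjectiveDimensionLT_X₃_iff d hI).symm⟩

theorem hasInjectiveDimensionLT_one_iff_baer {Λ : Type u} [Ring Λ] (M : Type u) [AddCommGroup M]
    [Module Λ M] : HasInjectiveDimensionLT (ModuleCat.of Λ M) 1 ↔ Module.Baer Λ M := by
  rw [← injective_iff_hasInjectiveDimensionLT_one, ← Module.injective_iff_injective_object,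
    Module.Baer.iff_injective]

variable (k : Type v) {Λ : Type u} [Field k] [Ring Λ] [Algebra k Λ] [Module.Finite k Λ]

/-- `Extʲ⁺¹(Λ, Hom_k(W, M)) = 0` over `Λᵉ` for all `j` from the injective dimension of `M` on. -/
theorem extendsFromKer_homBimodule_of_hasInjectiveDimensionLT (W : Type*) [AddCommGroup W]
    [Module k W] [Module Λ W] [IsScalarTower k Λ W] (d : ℕ) (M : Type u) [AddCommGroup M]
    [Module k M] [Module Λ M] [IsScalarTower k Λ M]
    (hM : HasInjectiveDimensionLT (ModuleCat.of Λ M) (d + 1)) (j : ℕ) (hj : d ≤ j) :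
    ExtendsFromKer (projectiveCoverπ (iteratedSyzygy j (regularBimodule k Λ)))
      (HomBimodule k W M) := by
  have hbaer (I : Type u) [AddCommGroup I] [Module k I] [Module Λ I] [IsScalarTower k Λ I]
      (hI : Module.Baer Λ I) (j : ℕ) :
      ExtendsFromKer (projectiveCoverπ (iteratedSyzygy j (regularBimodule k Λ)))
        (HomBimodule k W I) := by
    obtain ⟨ρ, hρ, hρ'⟩ := (isProjectiveAlong_ofOp_iteratedSyzygy k Λ j).exists_retraction
      (isProjectiveCover_projectiveCoverπ _).surjective
    exact .homBimodule_of_baer hI ρ hρ hρ'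
  induction d generalizing M j with
  | zero => exact hbaer M ((hasInjectiveDimensionLT_one_iff_baer M).1 hM) j
  | succ d ih =>
    obtain ⟨I, J, i, q, hi, hiq, hq, hI, hJ⟩ := exists_baer_shortExact (Λ := Λ) M
    let _ : Module k I := Module.compHom I (algebraMap k Λ)
    let _ : Module k J := Module.compHom J (algebraMap k Λ)
    have : IsScalarTower k Λ I := .of_algebraMap_smul fun _ _ ↦ rfl
    have : IsScalarTower k Λ J := .of_algebraMap_smul fun _ _ ↦ rfl
    obtain ⟨j, rfl⟩ := Nat.exists_eq_succ_of_ne_zero (show j ≠ 0 by omega)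
    have h := isProjectiveCover_projectiveCoverπ (iteratedSyzygy j (regularBimodule k Λ))
    have := h.projective
    exact ExtendsFromKer.left_of_shortExact (π := projectiveCoverπ _)
      (isProjectiveCover_projectiveCoverπ _).surjective
      (HomBimodule.map_injective hi) (HomBimodule.map_exact hi hiq) (HomBimodule.map_surjective hq)
      (ih J ((hJ d).1 hM) j (by omega)) (hbaer I hI (j + 1))

/-- A `Λ`-linear map `W → J` is the same as a bimodule map `Λ → Hom_k(W, J)`, so it lifts to `I` when
`Ext¹(Λ, Hom_k(W, C)) = 0` over `Λᵉ`. -/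
theorem exists_lift_of_extendsFromKer_regularBimodule {W C I J : Type*} [AddCommGroup W]
    [Module k W] [Module Λ W] [IsScalarTower k Λ W] [AddCommGroup C] [Module k C] [Module Λ C]
    [IsScalarTower k Λ C] [AddCommGroup I] [Module k I] [Module Λ I] [IsScalarTower k Λ I]
    [AddCommGroup J] [Module k J] [Module Λ J] [IsScalarTower k Λ J]
    {i : C →ₗ[Λ] I} {q : I →ₗ[Λ] J} (hi : Function.Injective i) (hiq : Function.Exact i q)
    (hq : Function.Surjective q)
    (h : ExtendsFromKer (projectiveCoverπ (regularBimodule k Λ)) (HomBimodule k W C))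
    (f : W →ₗ[Λ] J) : ∃ g : W →ₗ[Λ] I, ∀ w, q (g w) = f w := by
  have hcov := isProjectiveCover_projectiveCoverπ (regularBimodule k Λ)
  have := hcov.projective
  let f' : Λ →ₗ[EnvelopingAlgebra k Λ] HomBimodule k W J :=
    EnvelopingAlgebra.linearMapOfTmul
      (AddMonoidHom.mk' (fun x ↦ (x • f.restrictScalars k : W →ₗ[k] J))
        fun _ _ ↦ LinearMap.ext fun w ↦ add_smul _ _ (f w)) fun a b x ↦ by
      ext w
      rw [HomBimodule.tmul_smul_apply, EnvelopingAlgebra.tmul_smul]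
      change (a * x * b.unop) • f w = a • x • f (b.unop • w)
      rw [map_smul, smul_smul, smul_smul, mul_assoc]
  obtain ⟨t, ht⟩ := h.exists_lift hcov.surjective (HomBimodule.map_injective hi)
    (HomBimodule.map_exact hi hiq) (HomBimodule.map_surjective hq) f'
  let t' : Λ →ₗ[EnvelopingAlgebra k Λ] HomBimodule k W I := t
  -- `1 ∈ Λ` is central, so its image is not only `k`-linear but `Λ`-linear
  have ht' : ∀ (a : Λ) w, t' 1 (a • w) = a • t' 1 w := fun a w ↦ by
    have h1 : (a ⊗ₜ[k] 1 : EnvelopingAlgebra k Λ) • (1 : Λ) =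
        (1 ⊗ₜ[k] MulOpposite.op a : EnvelopingAlgebra k Λ) • (1 : Λ) := by
      simp [EnvelopingAlgebra.tmul_smul]
    have h2 := DFunLike.congr_fun (congrArg t' h1) w
    rw [map_smul, map_smul, HomBimodule.tmul_smul_apply, HomBimodule.tmul_smul_apply] at h2
    simpa using h2.symm
  refine ⟨{ toFun := t' 1, map_add' := LinearMap.map_add (t' 1 : W →ₗ[k] I), map_smul' := ht' },
    fun w ↦ ?_⟩
  have h3 := DFunLike.congr_fun (ht (1 : Λ)) w
  exact h3.trans (one_smul Λ (f w))

/-- If `M` has injective dimension at most `d + 1` and `Extᵈ⁺¹(Λ, Hom_k(DΛ, M)) = 0` over `Λᵉ`, then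
`M` has injective dimension at most `d`. After dimension shifting, `d = 0`. Then all maps from `DΛ` to
the injective cokernel `J` of `M → I` lift to `I`; so do those from any `Λ ⧸ 𝔞`, since this module
embeds in a power of `DΛ`, and this is Baer's criterion for `M`. -/
theorem hasInjectiveDimensionLT_of_extendsFromKer (d : ℕ) (M : Type u) [AddCommGroup M]
    [Module k M] [Module Λ M] [IsScalarTower k Λ M]
    (hM : HasInjectiveDimensionLT (ModuleCat.of Λ M) (d + 2))
    (h : ExtendsFromKer (projectiveCoverπ (iteratedSyzygy d (regularBimodule k Λ)))
      (HomBimodule k (DualModule k Λ) M)) :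
    HasInjectiveDimensionLT (ModuleCat.of Λ M) (d + 1) := by
  induction d generalizing M with
  | zero =>
    obtain ⟨I, J, i, q, hi, hiq, hq, hI, hJ⟩ := exists_baer_shortExact (Λ := Λ) M
    let _ : Module k I := Module.compHom I (algebraMap k Λ)
    let _ : Module k J := Module.compHom J (algebraMap k Λ)
    have : IsScalarTower k Λ I := .of_algebraMap_smul fun _ _ ↦ rfl
    have : IsScalarTower k Λ J := .of_algebraMap_smul fun _ _ ↦ rfl
    have hJ' : Module.Baer Λ J := (hasInjectiveDimensionLT_one_iff_baer J).1 ((hJ 0).1 hM)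
    refine (hasInjectiveDimensionLT_one_iff_baer M).2 fun 𝔞 f ↦ ?_
    obtain ⟨e, he⟩ := hI 𝔞 (i ∘ₗ f)
    -- `e` sends `𝔞` into `M`, so it induces a map from `Λ ⧸ 𝔞` to `J`
    obtain ⟨c, hc⟩ := LinearMap.exists_comp_eq_of_ker_le 𝔞.mkQ_surjective (q ∘ₗ e) fun x hx ↦ by
      rw [Submodule.ker_mkQ] at hx
      simp [he x hx, hiq.apply_apply_eq_zero]
    obtain ⟨m, s, hs⟩ := exists_injective_pi_dualModule k Λ (Λ ⧸ 𝔞)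
    obtain ⟨c', hc'⟩ := hJ'.extension_property s hs c
    choose g hg using fun l ↦ exists_lift_of_extendsFromKer_regularBimodule k hi hiq hq h
      (c' ∘ₗ LinearMap.single Λ (fun _ ↦ DualModule k Λ) l)
    let g' : (Fin m → DualModule k Λ) →ₗ[Λ] I := LinearMap.lsum Λ _ ℕ g
    have hg' : q ∘ₗ g' = c' := by
      refine LinearMap.pi_ext' fun l ↦ LinearMap.ext fun w ↦ ?_
      change q (g' (Pi.single l w)) = _
      rw [LinearMap.lsum_piSingle, hg]
    -- subtracting the lift of `Λ ⧸ 𝔞 → J` moves `e` into `M` without changing it on `𝔞`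
    obtain ⟨r, hr⟩ := LinearMap.exists_lift_of_mem_range hi (e - g' ∘ₗ s ∘ₗ 𝔞.mkQ) fun x ↦ by
      refine (hiq _).1 ?_
      have h1 : q (g' (s (𝔞.mkQ x))) = q (e x) := by
        rw [← LinearMap.comp_apply q g', hg', ← LinearMap.comp_apply c' s, hc', hc]
        rfl
      simp only [LinearMap.sub_apply, LinearMap.comp_apply, map_sub, h1, sub_self]
    refine ⟨r, fun x hx ↦ hi ?_⟩
    have h2 : 𝔞.mkQ x = 0 := (Submodule.Quotient.mk_eq_zero 𝔞).2 hx
    rw [hr, LinearMap.sub_apply, LinearMap.comp_apply, LinearMap.comp_apply, h2, map_zero, map_zero,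
      sub_zero, he x hx]
    rfl
  | succ d ih =>
    obtain ⟨I, J, i, q, hi, hiq, hq, hI, hJ⟩ := exists_baer_shortExact (Λ := Λ) M
    let _ : Module k I := Module.compHom I (algebraMap k Λ)
    let _ : Module k J := Module.compHom J (algebraMap k Λ)
    have : IsScalarTower k Λ I := .of_algebraMap_smul fun _ _ ↦ rfl
    have : IsScalarTower k Λ J := .of_algebraMap_smul fun _ _ ↦ rfl
    have hcov := isProjectiveCover_projectiveCoverπ (iteratedSyzygy (d + 1) (regularBimodule k Λ))
    have := hcov.projective
    have hI1 := (hasInjectiveDimensionLT_one_iff_baer I).2 hI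
    refine (hJ d).2 (ih J ((hJ (d + 1)).1 hM) ?_)
    exact ExtendsFromKer.right_of_shortExact
      (π := projectiveCoverπ (iteratedSyzygy d (regularBimodule k Λ))) hcov.surjective
      (HomBimodule.map_injective hi) (HomBimodule.map_exact hi hiq) (HomBimodule.map_surjective hq)
      (extendsFromKer_homBimodule_of_hasInjectiveDimensionLT k _ d I
        (hasInjectiveDimensionLT_of_ge _ 1 _ (by omega)) d le_rfl) h

/-- `Ext¹(Ωʲ, Λᵉ) = 0` for `j ≥ d`. -/
theorem IsGorensteinRingOfDim.extendsFromKer {d : ℕ} (hΛ : IsGorensteinRingOfDim d Λ) {j : ℕ}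
    (hj : d ≤ j) : ExtendsFromKer (projectiveCoverπ (iteratedSyzygy j (regularBimodule k Λ)))
      (EnvelopingAlgebra k Λ) := by
  refine (extendsFromKer_homBimodule_of_hasInjectiveDimensionLT k (DualModule k Λ) d Λ ?_ j
    hj).of_equiv_right (nonempty_homBimodule_dualModule_equiv k Λ).some
  exact (injectiveDimension_le_iff _ _).1 hΛ.injectiveDimension_left.le

/-- `Ext¹(Ωᵈ, Λᵉ) ≠ 0` if `Λ` is Gorenstein of dimension `d + 1`. -/
theorem IsGorensteinRingOfDim.not_extendsFromKer {d : ℕ}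
    (hΛ : IsGorensteinRingOfDim (d + 1) Λ) :
    ¬ ExtendsFromKer (projectiveCoverπ (iteratedSyzygy d (regularBimodule k Λ)))
      (EnvelopingAlgebra k Λ) := fun h ↦ by
  have h1 := hasInjectiveDimensionLT_of_extendsFromKer k d Λ
    ((injectiveDimension_le_iff _ (d + 1)).1 hΛ.injectiveDimension_left.le)
    (h.of_equiv_right (nonempty_homBimodule_dualModule_equiv k Λ).some.symm)
  exact (injectiveDimension_lt_iff.2 h1).ne hΛ.injectiveDimension_left

end InjectiveDimension

theorem theorem4p4 (k : Type v) (Λ : Type u) [Field k] [Ring Λ] [Algebra k Λ] [Module.Finite k Λ]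
    (n p d : ℕ) (hper : IsEventuallyPeriodicAlgebra k Λ n p) (hGor : IsGorensteinRingOfDim d Λ) :
    (d ≤ n ∧ n ≤ d + 1) ∧
    (∃ P : FGModuleCat.{u} (EnvelopingAlgebra k Λ),
      Module.Projective (EnvelopingAlgebra k Λ) P ∧
      Nonempty ((iteratedSyzygy (d + p) (regularBimodule k Λ) × P) ≃ₗ[EnvelopingAlgebra k Λ]
        iteratedSyzygy d (regularBimodule k Λ))) ∧
    (n = d ↔ HasNoProjectiveSummand (EnvelopingAlgebra k Λ)
      (iteratedSyzygy d (regularBimodule k Λ))) := by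
  obtain ⟨hdim, ⟨hp, hiso⟩, -⟩ := hper
  rw [iteratedSyzygy_iteratedSyzygy] at hiso
  have hE : ∀ j, d ≤ j → ExtendsFromKer (projectiveCoverπ (iteratedSyzygy j (regularBimodule k Λ)))
      (EnvelopingAlgebra k Λ) := fun j hj ↦ hGor.extendsFromKer k hj
  -- `n` is at most any index from which the syzygies have period `p`
  have hmin : ∀ m, Nonempty (iteratedSyzygy (m + p) (regularBimodule k Λ)
      ≃ₗ[EnvelopingAlgebra k Λ] iteratedSyzygy m (regularBimodule k Λ)) → n ≤ m := fun m hm ↦ by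
    have : IsPeriodicModule (iteratedSyzygy m (regularBimodule k Λ)) :=
      ⟨p, hp, by rwa [iteratedSyzygy_iteratedSyzygy]⟩
    exact_mod_cast hdim.symm.le.trans (iInf₂_le m this)
  have hdn : d ≤ n := by
    by_contra! hlt
    obtain ⟨d, rfl⟩ := Nat.exists_eq_succ_of_ne_zero (show d ≠ 0 by omega)
    obtain ⟨m, rfl⟩ := Nat.exists_eq_add_of_le (show n ≤ d by omega)
    -- going around the period often enough leads from `d` to an index above the Gorenstein dimension
    obtain ⟨e⟩ := nonempty_iteratedSyzygy_equiv
      (nonempty_iteratedSyzygy_equiv_add_mul hiso (n + m + 1)) m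
    exact hGor.not_extendsFromKer k (extendsFromKer_congr (hE _ (by nlinarith)) e)
  obtain ⟨m, rfl⟩ := Nat.exists_eq_add_of_le hdn
  refine ⟨⟨hdn, ?_⟩, exists_iteratedSyzygy_prod_equiv hp hE hiso, ?_⟩
  · rcases m with _ | m
    · omega
    have hE' := fun j (hj : d + 1 ≤ j) ↦ hE j (by omega)
    refine hmin _ ((hasNoProjectiveSummand_iteratedSyzygy_iff (m := m) hp hE' ?_).1
      (hasNoProjectiveSummand_syzygy (hE d le_rfl)))
    rwa [show d + 1 + m = d + (m + 1) by omega]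
  · rw [hasNoProjectiveSummand_iteratedSyzygy_iff hp hE hiso]
    refine ⟨fun h ↦ ?_, fun h ↦ le_antisymm (hmin d h) hdn⟩
    rwa [h] at hiso
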